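/- Let $(t_n)_{n\ge 1}$ be a sequence of strictly positive real numbers which decreases (not necessarily strictly) to $0$, and for each $n\ge 1$ let $\rho_n$ be a norm on $\mathbb{R}^n$ which is a lattice norm, i.e. $\rho_n(x)\le\rho_n(y)$ whenever $|x|\le|y|$ coordinatewise, and which is normalized, i.e. $\|x\|_\infty\le\rho_n(x)\le\|x\|_1$ for all $x\in\mathbb{R}^n$. Let $E$ be a real Banach space with a Schauder basis $(e_k)_{k\ge 1}$, i.e. every $x\in E$ has a unique representation as a norm-convergent series $x=\sum_{k=1}^\infty a_ke_k$ with real scalars $a_k$. Suppose that $$\Bigl\|\sum_{k=1}^\infty a_ke_k\Bigr\| = \sup_{n\ge 1}\, t_n\,\rho_n(a_1^*,\dots,a_n^*)$$ for every element $\sum a_ke_k$ of $E$, where $(a_k^*)$ is the decreasing rearrangement of the sequence $(|a_k|)$, that is, $a_k^*=\min\{c\ge 0 : |a_j|>c \text{ for at most } k-1 \text{ indices } j\}$. (In particular, the supremum is finite for every element of $E$.) Then $E$ is isomorphic (linearly homeomorphic) to a subspace of $C(\omega^\omega)$, the Banach space of continuous real-valued functions, with the supremum norm, on the compact space $\omega^\omega+1=\{\beta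 : \beta\le\omega^\omega\}$ of ordinals with the order topology. -/

import Mathlib

/-- A norm `ρ` on `ℝᵐ` (a seminorm which vanishes only at `0`) is a lattice norm
if `ρ x ≤ ρ y` whenever `|x| ≤ |y|` coordinatewise. -/
structure IsLatticeNorm {m : ℕ} (ρ : Seminorm ℝ (Fin m → ℝ)) : Prop where
  eq_zero_of_apply_eq_zero : ∀ x, ρ x = 0 → x = 0
  monotone_abs : ∀ x y, |x| ≤ |y| → ρ x ≤ ρ y

/-- A norm `ρ` on `ℝᵐ` is normalized if `‖·‖_∞ ≤ ρ ≤ ‖·‖_1`. The norm `‖x‖` of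
`x : Fin m → ℝ` is the supremum norm. -/
structure IsNormalizedNorm {m : ℕ} (ρ : Seminorm ℝ (Fin m → ℝ)) : Prop where
  sup_norm_le : ∀ x, ‖x‖ ≤ ρ x
  le_one_norm : ∀ x, ρ x ≤ ∑ i, |x i|

/-- The decreasing rearrangement `a*` of the sequence `(|a_k|)`, indexed from `0`: `a*_n` is the
least `c ≥ 0` such that at most `n` of the numbers `|a_k|` exceed `c`. For `a` converging to `0`,
this lists the nonzero `|a_k|` in decreasing order, with multiplicity, followed by zeros if there
are only finitely many of them. -/
noncomputable def decreasingRearrangement (a : ℕ → ℝ) (n : ℕ) : ℝ :=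
  sInf {c : ℝ | 0 ≤ c ∧ {k : ℕ | c < |a k|}.encard ≤ n}

/-- The series `∑ a_k e_k` converges in norm to `x` (in the given order of the terms). -/
def IsExpansion {E : Type*} [NormedAddCommGroup E] [NormedSpace ℝ E]
    (e : ℕ → E) (a : ℕ → ℝ) (x : E) : Prop :=
  Filter.Tendsto (fun N : ℕ => ∑ k ∈ Finset.range N, a k • e k) Filter.atTop (nhds x)

/-- `(e_k)` is a (Schauder) basis: every `x` has a unique representation `x = ∑ a_k e_k`. -/
def IsBasisSequence {E : Type*} [NormedAddCommGroup E] [NormedSpace ℝ E] (e : ℕ → E) : Prop :=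
  ∀ x : E, ∃! a : ℕ → ℝ, IsExpansion e a x

/-- The compact space `α + 1 = {β : β ≤ α}` of ordinals, with its order topology. -/
abbrev OrdinalInterval (α : Ordinal.{0}) : Type 1 := Set.Icc (0 : Ordinal.{0}) α

/-- `C(α)`: the continuous real-valued functions on the compact space `α + 1`, with the
supremum norm. -/
abbrev COrdinal (α : Ordinal.{0}) : Type 1 := C(OrdinalInterval α, ℝ)

/-! ### Continuous images of ordinal intervals -/

section OrdinalParametrization

open Filter Topology

/-! It suffices to find a pointwise continuous family of coordinate functionals, indexed by `[0, ω ^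
ω]`, each dominated by the norm `P` and together norming up to a constant; evaluation then embeds
`E` into `C(ω ^ ω)`.

For each `n` take the functionals dominated by `P` with at most `n + 1` nonzero coordinates, all of
size at most `t n` and in a grid `δℤ`. Sorting by the position of the first nonzero coordinate shows
by induction that they form a continuous image of `(0, ω ^ (n + 1)]` (`ordinalParam_extensionSet`).
Since `t n → 0`, these sets converge to the zero functional, so their union is a continuous image of
`(0, ω ^ ω]`.

They are norming although `t n * ρ n (a*)` need not be convex in `a`. It is at most twice the
infimal convolution of `P` and `t n • ‖·‖₁` (`mul_apply_le_inf`), because `P` at most doubles when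
each term is repeated. Hahn–Banach for this seminorm gives a functional dominated by `P` with
coordinates at most `t n`; restricting it to the `n + 1` largest entries of `a` and rounding towards
`0` costs only a fraction of `P a` (`exists_gridFunctional`). -/

/-- `S` is the image of the interval `(0, b]` of ordinals under a function which is continuous at
every point of that interval. -/
def OrdinalParam {X : Type*} [TopologicalSpace X] (b : Ordinal.{0}) (S : Set X) : Prop :=
  ∃ φ : Ordinal.{0} → X, (∀ β, 0 < β → β ≤ b → ContinuousAt φ β) ∧ (∀ β, φ β ∈ S) ∧
    ∀ s ∈ S, ∃ β, 0 < β ∧ β ≤ b ∧ φ β = s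

theorem ordinalParam_singleton {X : Type*} [TopologicalSpace X] {b : Ordinal.{0}} (hb : 0 < b)
    (x : X) : OrdinalParam b {x} :=
  ⟨fun _ => x, fun _ _ _ => continuousAt_const, fun _ => rfl, fun _ hs => ⟨b, hb, le_rfl, hs.symm⟩⟩

/-- Translates a piece `(a, a + b]` back to `(0, b]`, where its parametrization lives. -/
theorem continuousAt_ordinal_sub {a β : Ordinal.{0}} (h : a < β) :
    ContinuousAt (fun γ => γ - a) β := by
  refine tendsto_order.2 ⟨fun c hc => ?_, fun c hc => ?_⟩
  · filter_upwards [lt_mem_nhds (Ordinal.lt_sub.1 hc)] with γ hγ using Ordinal.lt_sub.2 hγ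
  · filter_upwards [gt_mem_nhds ((Ordinal.sub_lt_of_le h.le).1 hc), lt_mem_nhds h] with γ hγ hγ'
    exact (Ordinal.sub_lt_of_le hγ'.le).2 hγ

/-- Such intervals are open, being `(a, succ b)`. Hence parametrizations on consecutive pieces can
be glued without any matching condition at the end points. -/
theorem Ioc_mem_nhds_ordinal {a b β : Ordinal.{0}} (h : a < β) (h' : β ≤ b) :
    Set.Ioc a b ∈ 𝓝 β := by
  filter_upwards [lt_mem_nhds h, gt_mem_nhds (Order.lt_succ_of_le h')] with γ h1 h2
  exact ⟨h1, Order.lt_succ_iff.1 h2⟩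

/-- Consecutive intervals `(a j, a j + b j]` which exhaust `(0, c)` parametrize the sets `S j`;
if these converge to the point `x`, then `(0, c]` parametrizes their union with `{x}`. -/
theorem OrdinalParam.glue {X : Type*} [TopologicalSpace X] {a b : ℕ → Ordinal.{0}}
    {c : Ordinal.{0}} (ha0 : a 0 = 0) (ha : ∀ j, a (j + 1) = a j + b j) (hac : ∀ j, a j < c)
    (hc : ∀ β < c, ∃ j, β ≤ a j) {S : ℕ → Set X} (hS : ∀ j, OrdinalParam (b j) (S j)) {x : X}
    (hx : ∀ s : ℕ → X, (∀ j, s j ∈ S j) → Tendsto s atTop (𝓝 x)) :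
    OrdinalParam c (insert x (⋃ j, S j)) := by
  classical
  choose ψ hψc hψm hψs using hS
  have hmono : Monotone a := monotone_nat_of_le_succ fun j => by rw [ha]; exact le_self_add
  -- The default `x` is taken at `0` and from `c` on.
  let φ : Ordinal.{0} → X := fun β =>
    if h : ∃ j, a j < β ∧ β ≤ a (j + 1) then ψ h.choose (β - a h.choose) else x
  have hφ : ∀ j β, a j < β → β ≤ a (j + 1) → φ β = ψ j (β - a j) := by
    intro j β h1 h2
    have h : ∃ j, a j < β ∧ β ≤ a (j + 1) := ⟨j, h1, h2⟩
    have hj : h.choose = j := by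
      obtain ⟨h3, h4⟩ := h.choose_spec
      apply le_antisymm
      · by_contra! hlt
        exact absurd (h3.trans_le h2) (not_lt.2 (hmono hlt))
      · by_contra! hlt
        exact absurd (h1.trans_le h4) (not_lt.2 (hmono hlt))
    simp only [φ, dif_pos h]
    rw [hj]
  have hpiece : ∀ β, 0 < β → β < c → ∃ j, a j < β ∧ β ≤ a (j + 1) := by
    intro β h0 hβ
    have hex := hc β hβ
    have hne : Nat.find hex ≠ 0 := by
      intro h
      have := Nat.find_spec hex
      rw [h, ha0] at this
      exact absurd h0 (not_lt.2 this)
    obtain ⟨j, hj⟩ := Nat.exists_eq_succ_of_ne_zero hne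
    refine ⟨j, not_le.1 (Nat.find_min hex (by omega)), ?_⟩
    have := Nat.find_spec hex
    rwa [hj] at this
  have hφx : ∀ β, c ≤ β → φ β = x := by
    intro β hβ
    have h : ¬ ∃ j, a j < β ∧ β ≤ a (j + 1) := by
      rintro ⟨j, -, h⟩
      exact absurd (h.trans_lt (hac _)) (not_lt.2 hβ)
    simp only [φ, dif_neg h]
  -- Convergence of all selections is uniform: otherwise, choosing a point outside `U` whenever
  -- possible gives a selection that does not converge to `x`.
  have hev : ∀ U ∈ 𝓝 x, ∃ J, ∀ j ≥ J, S j ⊆ U := by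
    intro U hU
    by_contra! hcon
    have : ∀ j, ∃ y ∈ S j, (¬ S j ⊆ U → y ∉ U) := by
      intro j
      by_cases h : S j ⊆ U
      · exact ⟨ψ j 0, hψm j 0, fun h' => absurd h h'⟩
      · obtain ⟨y, hy, hyU⟩ := Set.not_subset.1 h
        exact ⟨y, hy, fun _ => hyU⟩
    choose s hs hsU using this
    obtain ⟨J, hJ⟩ := eventually_atTop.1 ((hx s hs).eventually hU)
    obtain ⟨j, hj, hjU⟩ := hcon J
    exact hsU j hjU (hJ j hj)
  refine ⟨φ, fun β h0 hβ => ?_, fun β => ?_, ?_⟩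
  · rcases hβ.lt_or_eq with hβ | rfl
    · obtain ⟨j, h1, h2⟩ := hpiece β h0 hβ
      have hsub : ContinuousAt (fun γ => ψ j (γ - a j)) β := by
        refine ContinuousAt.comp (g := ψ j) (hψc j _ ?_ ?_) (continuousAt_ordinal_sub h1)
        · exact Ordinal.lt_sub.2 (by simpa using h1)
        · exact Ordinal.sub_le.2 (by rwa [← ha])
      refine hsub.congr ?_
      filter_upwards [Ioc_mem_nhds_ordinal h1 h2] with γ hγ
      exact (hφ j γ hγ.1 hγ.2).symm
    · rw [ContinuousAt, hφx β le_rfl]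
      intro U hU
      obtain ⟨J, hJ⟩ := hev U hU
      rw [mem_map]
      filter_upwards [Ioc_mem_nhds_ordinal (hac J) le_rfl] with γ hγ
      rcases hγ.2.lt_or_eq with hlt | rfl
      · obtain ⟨j, h1, h2⟩ := hpiece γ (bot_le.trans_lt hγ.1) hlt
        have hjJ : J ≤ j := by
          by_contra! hcon
          exact absurd (hγ.1.trans_le h2) (not_lt.2 (hmono hcon))
        show φ γ ∈ U
        rw [hφ j γ h1 h2]
        exact hJ j hjJ (hψm j _)
      · show φ γ ∈ U
        rw [hφx γ le_rfl]
        exact mem_of_mem_nhds hU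
  · by_cases h : ∃ j, a j < β ∧ β ≤ a (j + 1)
    · obtain ⟨j, h1, h2⟩ := h
      rw [hφ j β h1 h2]
      exact Or.inr (Set.mem_iUnion.2 ⟨j, hψm j _⟩)
    · simp only [φ, dif_neg h]
      exact Or.inl rfl
  · rintro s (rfl | hs)
    · exact ⟨c, ha0 ▸ hac 0, le_rfl, hφx c le_rfl⟩
    · obtain ⟨j, hj⟩ := Set.mem_iUnion.1 hs
      obtain ⟨β, h0, hβ, rfl⟩ := hψs j s hj
      have h1 : a j < a j + β := by simpa using h0
      have h2 : a j + β ≤ a (j + 1) := by rw [ha]; gcongr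
      refine ⟨a j + β, bot_le.trans_lt h1, h2.trans (hac _).le, ?_⟩
      rw [hφ j _ h1 h2, Ordinal.add_sub_cancel]

/-! ### Sequences with few nonzero values -/

/-- Functions in `D` which agree with `f` below `k` and have at most `m` nonzero values from `k`
on. -/
def extensionSet (D : Set (ℕ → ℝ)) (f : ℕ → ℝ) (k m : ℕ) : Set (ℕ → ℝ) :=
  {g | g ∈ D ∧ (∀ i < k, g i = f i) ∧ {i | k ≤ i ∧ g i ≠ 0}.encard ≤ m}

/-- Split according to the first nonzero position `i ≥ k` and the value `v` there; truncating `g`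
after `i` gives `Function.update f i v`, which is why `D` must be closed under truncation. -/
theorem extensionSet_succ {D : Set (ℕ → ℝ)}
    (hD : ∀ g ∈ D, ∀ k, (fun i => if i < k then g i else 0) ∈ D) {f : ℕ → ℝ} (hf : f ∈ D) {k : ℕ}
    (hfk : ∀ i, k ≤ i → f i = 0) (m : ℕ) :
    extensionSet D f k (m + 1) = {g | g = f ∨ ∃ i v, k ≤ i ∧ v ≠ 0 ∧ Function.update f i v ∈ D ∧
      g ∈ extensionSet D (Function.update f i v) (i + 1) m} := by
  classical
  ext g
  constructor
  · rintro ⟨hg, hgf, hcard⟩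
    by_cases h : ∃ i, k ≤ i ∧ g i ≠ 0
    · right
      obtain ⟨h1, h2⟩ := Nat.find_spec h
      set i := Nat.find h
      have hmin : ∀ l < i, k ≤ l → g l = 0 := fun l hl hkl => by
        by_contra hne
        exact Nat.find_min h hl ⟨hkl, hne⟩
      have hup : Function.update f i (g i) = fun l => if l < i + 1 then g l else 0 := by
        ext l
        rcases lt_trichotomy l i with hl | rfl | hl
        · rw [Function.update_of_ne hl.ne, if_pos (by omega)]
          by_cases hlk : l < k
          · exact (hgf l hlk).symm
          · rw [hfk l (by omega), hmin l hl (by omega)]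
        · simp
        · rw [Function.update_of_ne hl.ne', if_neg (by omega), hfk l (by omega)]
      refine ⟨i, g i, h1, h2, ?_, hg, ?_, ?_⟩
      · rw [hup]; exact hD g hg _
      · intro l hl
        rw [hup]; simp [hl]
      · have hsub : insert i {l | i + 1 ≤ l ∧ g l ≠ 0} ⊆ {l | k ≤ l ∧ g l ≠ 0} := by
          rintro l (rfl | ⟨hl, hl'⟩)
          · exact ⟨h1, h2⟩
          · exact ⟨by omega, hl'⟩
        have := (Set.encard_le_encard hsub).trans hcard
        rw [Set.encard_insert_of_notMem (by simp)] at this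
        push_cast at this
        exact (ENat.add_le_add_iff_right ENat.one_ne_top).1 this
    · left
      push Not at h
      ext l
      by_cases hl : l < k
      · exact hgf l hl
      · rw [h l (by omega), hfk l (by omega)]
  · rintro (rfl | ⟨i, v, hki, hv, hup, hg, hgf, hcard⟩)
    · refine ⟨hf, fun _ _ => rfl, ?_⟩
      have : {i | k ≤ i ∧ g i ≠ 0} = ∅ := by
        ext i
        simpa using hfk i
      simp [this]
    · refine ⟨hg, fun l hl => ?_, ?_⟩
      · rw [hgf l (by omega), Function.update_of_ne (by omega)]
      · have hsub : {l | k ≤ l ∧ g l ≠ 0} ⊆ insert i {l | i + 1 ≤ l ∧ g l ≠ 0} := by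
          rintro l ⟨hl, hl'⟩
          rcases lt_trichotomy l i with h | rfl | h
          · exfalso
            apply hl'
            rw [hgf l (by omega), Function.update_of_ne (by omega), hfk l hl]
          · exact Or.inl rfl
          · exact Or.inr ⟨h, hl'⟩
        refine (Set.encard_le_encard hsub).trans ((Set.encard_insert_le _ _).trans ?_)
        push_cast
        gcongr

/-- If the members of `D` have values in a finite set and `D` is closed under truncation, then
the members with at most `m` nonzero values from `k` on and prescribed values below `k` form a
continuous image of `(0, ω ^ m]`. -/
theorem ordinalParam_extensionSet {D : Set (ℕ → ℝ)} {V : Set ℝ} (hV : V.Finite)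
    (hDV : ∀ g ∈ D, ∀ i, g i ∈ V)
    (hD : ∀ g ∈ D, ∀ k, (fun i => if i < k then g i else 0) ∈ D) (m : ℕ) :
    ∀ (k : ℕ) (f : ℕ → ℝ), f ∈ D → (∀ i, k ≤ i → f i = 0) →
      OrdinalParam (Ordinal.omega0 ^ (m : Ordinal.{0})) (extensionSet D f k m) := by
  classical
  induction m with
  | zero =>
    intro k f hf hfk
    have : extensionSet D f k 0 = {f} := by
      ext g
      simp only [extensionSet, Nat.cast_zero, nonpos_iff_eq_zero, Set.encard_eq_zero,
        Set.mem_ofPred_eq, Set.mem_singleton_iff]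
      constructor
      · rintro ⟨-, h1, h2⟩
        ext i
        by_cases hi : i < k
        · exact h1 i hi
        · rw [hfk i (by omega)]
          by_contra hne
          have : i ∈ {i | k ≤ i ∧ g i ≠ 0} := ⟨by omega, hne⟩
          rw [h2] at this
          exact this
      · rintro rfl
        refine ⟨hf, fun _ _ => rfl, ?_⟩
        ext i
        simpa using hfk i
    rw [this]
    exact ordinalParam_singleton (by simp) f
  | succ m ih =>
    intro k f hf hfk
    rw [extensionSet_succ hD hf hfk]
    have hVne : hV.toFinset.Nonempty := ⟨f 0, by simpa using hDV f hf 0⟩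
    obtain ⟨q, ⟨ev⟩⟩ := Finite.exists_equiv_fin hV.toFinset
    have hq : q ≠ 0 := by
      rintro rfl
      obtain ⟨v, hv⟩ := hVne
      exact (ev ⟨v, hv⟩).elim0
    have : NeZero q := ⟨hq⟩
    -- All pairs (position, value) are enumerated in blocks of length `q`, the number of values.
    -- Inadmissible pairs contribute the harmless piece `{f}`, so there are always `ω` pieces of
    -- length `ω ^ m`.
    let ι : ℕ → ℕ := fun j => (Nat.divModEquiv q j).1
    let w : ℕ → ℝ := fun j => ev.symm (Nat.divModEquiv q j).2
    let good : ℕ → Prop := fun j => k ≤ ι j ∧ w j ≠ 0 ∧ Function.update f (ι j) (w j) ∈ D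
    let S : ℕ → Set (ℕ → ℝ) := fun j =>
      if good j then extensionSet D (Function.update f (ι j) (w j)) (ι j + 1) m else {f}
    have hset : {g | g = f ∨ ∃ i v, k ≤ i ∧ v ≠ 0 ∧ Function.update f i v ∈ D ∧
        g ∈ extensionSet D (Function.update f i v) (i + 1) m} = insert f (⋃ j, S j) := by
      ext g
      simp only [Set.mem_ofPred_eq, Set.mem_insert_iff, Set.mem_iUnion]
      constructor
      · rintro (rfl | ⟨i, v, hki, hv, hup, hg⟩)
        · exact Or.inl rfl
        · right
          have hvV : v ∈ hV.toFinset := by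
            have := hDV _ hup i
            rw [Function.update_self] at this
            simpa using this
          refine ⟨(Nat.divModEquiv q).symm (i, ev ⟨v, hvV⟩), ?_⟩
          have h1 : ι ((Nat.divModEquiv q).symm (i, ev ⟨v, hvV⟩)) = i := by
            simp only [ι, Equiv.apply_symm_apply]
          have h2 : w ((Nat.divModEquiv q).symm (i, ev ⟨v, hvV⟩)) = v := by
            simp only [w, Equiv.apply_symm_apply, Equiv.symm_apply_apply]
          simp only [S, good, h1, h2]
          rw [if_pos ⟨hki, hv, hup⟩]
          exact hg
      · rintro (rfl | ⟨j, hj⟩)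
        · exact Or.inl rfl
        · by_cases hgj : good j
          · simp only [S, if_pos hgj] at hj
            exact Or.inr ⟨_, _, hgj.1, hgj.2.1, hgj.2.2, hj⟩
          · simp only [S, if_neg hgj] at hj
            exact Or.inl hj
    rw [hset]
    have hpos : (0 : Ordinal.{0}) < Ordinal.omega0 ^ (m : Ordinal.{0}) :=
      Ordinal.opow_pos _ Ordinal.omega0_pos
    refine OrdinalParam.glue (a := fun j => Ordinal.omega0 ^ (m : Ordinal.{0}) * (j : Ordinal.{0}))
      (b := fun _ => Ordinal.omega0 ^ (m : Ordinal.{0})) (by simp) (fun j => ?_) (fun j => ?_)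
      (fun β hβ => ?_) (fun j => ?_) (fun s hs => ?_)
    · push_cast; rw [mul_add, mul_one]
    · exact Ordinal.opow_mul_lt_opow (Ordinal.natCast_lt_omega0 j)
        (by exact_mod_cast Nat.lt_succ_self m)
    · push_cast at hβ
      rw [← Order.succ_eq_add_one] at hβ
      obtain ⟨n, hn⟩ := Ordinal.lt_omega0_opow_succ.1 hβ
      exact ⟨n, hn.le⟩
    · by_cases hgj : good j
      · simp only [S, if_pos hgj]
        refine ih _ _ hgj.2.2 fun i hi => ?_
        rw [Function.update_of_ne (by omega), hfk i (by have := hgj.1; omega)]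
      · simp only [S, if_neg hgj]
        exact ordinalParam_singleton hpos f
    -- Each position occurs for only `q` indices, so `ι j → ∞` and every fixed coordinate of `s j`
    -- is eventually that of `f`.
    · refine tendsto_pi_nhds.2 fun i => tendsto_const_nhds.congr' ?_
      have hι : Tendsto ι atTop atTop := by
        refine tendsto_atTop.2 fun b => ?_
        filter_upwards [eventually_ge_atTop (b * q)] with j hj
        exact (Nat.le_div_iff_mul_le (Nat.pos_of_ne_zero hq)).2 hj
      filter_upwards [hι.eventually_gt_atTop i] with j hj
      have h := hs j
      by_cases hgj : good j
      · simp only [S, if_pos hgj] at h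
        rw [h.2.1 i (by omega), Function.update_of_ne (by omega)]
      · simp only [S, if_neg hgj, Set.mem_singleton_iff] at h
        rw [h]

/-- Sets parametrized by `(0, ω ^ (n + 1)]` which converge to one of their points have a union
which is parametrized by `(0, ω ^ ω]`. -/
theorem ordinalParam_iUnion_omega0_opow_omega0 {X : Type*} [TopologicalSpace X] {S : ℕ → Set X}
    (hS : ∀ n : ℕ, OrdinalParam (Ordinal.omega0 ^ ((n + 1 : ℕ) : Ordinal.{0})) (S n)) {x : X}
    (hx0 : x ∈ ⋃ n, S n) (hx : ∀ s : ℕ → X, (∀ j, s j ∈ S j) → Tendsto s atTop (𝓝 x)) :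
    OrdinalParam (Ordinal.omega0 ^ Ordinal.omega0) (⋃ n, S n) := by
  let a : ℕ → Ordinal.{0} := fun n =>
    Nat.rec 0 (fun j y => y + Ordinal.omega0 ^ ((j + 1 : ℕ) : Ordinal.{0})) n
  have ha : ∀ j, a (j + 1) = a j + Ordinal.omega0 ^ ((j + 1 : ℕ) : Ordinal.{0}) := fun _ => rfl
  -- `a j = ω ^ 1 + ⋯ + ω ^ j` stays below `ω ^ (j + 1)`, which is closed under addition.
  have hac : ∀ j, a j < Ordinal.omega0 ^ ((j + 1 : ℕ) : Ordinal.{0}) := by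
    intro j
    induction j with
    | zero => exact Ordinal.opow_pos _ Ordinal.omega0_pos
    | succ j ih =>
      rw [ha]
      have hlt : Ordinal.omega0 ^ ((j + 1 : ℕ) : Ordinal.{0}) <
          Ordinal.omega0 ^ ((j + 1 + 1 : ℕ) : Ordinal.{0}) :=
        (Ordinal.opow_lt_opow_iff_right Ordinal.one_lt_omega0).2
          (by exact_mod_cast Nat.lt_succ_self _)
      exact Ordinal.isPrincipal_add_omega0_opow _ (ih.trans hlt) hlt
  have hle : ∀ n : ℕ, Ordinal.omega0 ^ (n : Ordinal.{0}) <
      (Ordinal.omega0 ^ Ordinal.omega0 : Ordinal.{0}) := fun n =>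
    (Ordinal.opow_lt_opow_iff_right Ordinal.one_lt_omega0).2 (Ordinal.natCast_lt_omega0 n)
  rw [← Set.insert_eq_of_mem hx0]
  refine OrdinalParam.glue (a := a) (b := fun n => Ordinal.omega0 ^ ((n + 1 : ℕ) : Ordinal.{0}))
    rfl ha (fun j => (hac j).trans (hle _)) (fun β hβ => ?_) hS hx
  obtain ⟨c, hc, hβc⟩ := (Ordinal.lt_opow_of_isSuccLimit Ordinal.omega0_ne_zero
    Ordinal.isSuccLimit_omega0).1 hβ
  obtain ⟨n, rfl⟩ := Ordinal.lt_omega0.1 hc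
  refine ⟨n + 1, hβc.le.trans ?_⟩
  rw [ha]
  refine le_trans ?_ le_add_self
  exact Ordinal.opow_le_opow_right Ordinal.omega0_pos (by exact_mod_cast Nat.le_succ n)

/-- A parametrization by `(0, b]` yields a continuous map on `[0, b]` with the same range. -/
theorem OrdinalParam.exists_continuousMap {X : Type*} [TopologicalSpace X] {b : Ordinal.{0}}
    {S : Set X} (h : OrdinalParam b S) : ∃ φ : C(OrdinalInterval b, X), Set.range φ = S := by
  obtain ⟨φ, hc, hm, hs⟩ := h
  refine ⟨⟨fun β => φ β, continuous_iff_continuousAt.2 fun β => ?_⟩, ?_⟩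
  · refine ContinuousAt.comp (g := φ) ?_ continuous_subtype_val.continuousAt
    -- The point `0` is isolated, so no continuity of `φ` is needed there.
    rcases eq_or_ne (β : Ordinal.{0}) 0 with h0 | h0
    · rw [h0, ContinuousAt, SuccOrder.nhds_eq_pure.2 Ordinal.not_isSuccLimit_zero]
      exact tendsto_pure_nhds _ _
    · exact hc _ (pos_iff_ne_zero.2 h0) β.2.2
  · ext s
    constructor
    · rintro ⟨β, rfl⟩
      exact hm _
    · intro hsS
      obtain ⟨β, h0, hb, rfl⟩ := hs s hsS
      exact ⟨⟨β, h0.le, hb⟩, rfl⟩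

end OrdinalParametrization

/-! ### Decreasing rearrangements -/

section Rearrangement

theorem decreasingRearrangement_le {a : ℕ → ℝ} {n : ℕ} {c : ℝ} (hc : 0 ≤ c)
    (h : {k : ℕ | c < |a k|}.encard ≤ n) : decreasingRearrangement a n ≤ c :=
  csInf_le ⟨0, fun _ hx => hx.1⟩ ⟨hc, h⟩

theorem decreasingRearrangement_nonneg (a : ℕ → ℝ) (n : ℕ) : 0 ≤ decreasingRearrangement a n :=
  Real.sInf_nonneg fun _ hx => hx.1

theorem exists_encard_le_of_bounded {a : ℕ → ℝ} (ha : ∃ M, ∀ k, |a k| ≤ M) (n : ℕ) :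
    {c : ℝ | 0 ≤ c ∧ {k : ℕ | c < |a k|}.encard ≤ n}.Nonempty := by
  obtain ⟨M, hM⟩ := ha
  refine ⟨M, (abs_nonneg _).trans (hM 0), ?_⟩
  have : {k : ℕ | M < |a k|} = ∅ := by
    ext k
    simpa using hM k
  simp [this]

theorem le_decreasingRearrangement {a : ℕ → ℝ} (ha : ∃ M, ∀ k, |a k| ≤ M) {n : ℕ} {d : ℝ}
    (h : ∀ c, 0 ≤ c → {k : ℕ | c < |a k|}.encard ≤ n → d ≤ c) :
    d ≤ decreasingRearrangement a n :=
  le_csInf (exists_encard_le_of_bounded ha n) fun c hc => h c hc.1 hc.2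

theorem decreasingRearrangement_mono {a b : ℕ → ℝ} (hb : ∃ M, ∀ k, |b k| ≤ M)
    (h : ∀ k, |a k| ≤ |b k|) (n : ℕ) :
    decreasingRearrangement a n ≤ decreasingRearrangement b n := by
  refine le_decreasingRearrangement hb fun c hc hcard => decreasingRearrangement_le hc ?_
  exact (Set.encard_le_encard fun k (hk : c < |a k|) => hk.trans_le (h k)).trans hcard

theorem decreasingRearrangement_congr_injective {a b : ℕ → ℝ} {σ : ℕ → ℕ}
    (hσ : Function.Injective σ) (h : ∀ k, |b (σ k)| = |a k|) (h0 : ∀ l, l ∉ Set.range σ → b l = 0)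
    (n : ℕ) : decreasingRearrangement b n = decreasingRearrangement a n := by
  unfold decreasingRearrangement
  congr 1
  ext c
  refine and_congr_right fun hc => ?_
  have : {k : ℕ | c < |b k|} = σ '' {k : ℕ | c < |a k|} := by
    ext l
    constructor
    · intro (hl : c < |b l|)
      by_cases hr : l ∈ Set.range σ
      · obtain ⟨k, rfl⟩ := hr
        exact ⟨k, by rwa [h] at hl, rfl⟩
      · rw [h0 l hr, abs_zero] at hl
        exact absurd hc (not_le.2 hl)
    · rintro ⟨k, hk, rfl⟩
      show c < |b (σ k)|
      rw [h]
      exact hk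
  rw [this, hσ.encard_image]

theorem decreasingRearrangement_of_antitone {a : ℕ → ℝ} (ha : Antitone fun k => |a k|) (n : ℕ) :
    decreasingRearrangement a n = |a n| := by
  apply le_antisymm
  · refine decreasingRearrangement_le (abs_nonneg _) ?_
    have hsub : {k : ℕ | |a n| < |a k|} ⊆ Finset.range n := by
      intro k (hk : |a n| < |a k|)
      by_contra hcon
      exact absurd (ha (by simpa using hcon : n ≤ k)) (not_le.2 hk)
    refine (Set.encard_le_encard hsub).trans ?_
    rw [Set.encard_coe_eq_coe_finsetCard, Finset.card_range]
  · refine le_decreasingRearrangement ⟨|a 0|, fun k => ha (Nat.zero_le k)⟩ fun c _ hcard => ?_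
    by_contra! hlt
    have hsub : (Finset.range (n + 1) : Set ℕ) ⊆ {k : ℕ | c < |a k|} := by
      intro k hk
      have : k ≤ n := by simpa [Nat.lt_succ_iff] using hk
      exact hlt.trans_le (ha this)
    have := (Set.encard_le_encard hsub).trans hcard
    rw [Set.encard_coe_eq_coe_finsetCard, Finset.card_range] at this
    have : n + 1 ≤ n := by exact_mod_cast this
    omega

/-- If at most `n / 2` of the `|u k|` exceed `c` and at most `n / 2` of the `|v k|` exceed `d`, then
at most `n` of the `|u k + v k|` exceed `c + d`. -/
theorem decreasingRearrangement_add_le {u v : ℕ → ℝ} (hu : ∃ M, ∀ k, |u k| ≤ M)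
    (hv : ∃ M, ∀ k, |v k| ≤ M) (n : ℕ) : decreasingRearrangement (u + v) n ≤
      decreasingRearrangement u (n / 2) + decreasingRearrangement v (n / 2) := by
  rw [← sub_le_iff_le_add]
  refine le_decreasingRearrangement hu fun c hc hcc => ?_
  rw [sub_le_comm]
  refine le_decreasingRearrangement hv fun d hd hdd => ?_
  rw [sub_le_iff_le_add']
  refine decreasingRearrangement_le (add_nonneg hc hd) ?_
  have hsub : {k : ℕ | c + d < |(u + v) k|} ⊆ {k | c < |u k|} ∪ {k | d < |v k|} := by
    intro k (hk : c + d < |u k + v k|)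
    by_contra hcon
    have h1 : ¬ c < |u k| := fun h => hcon (Or.inl h)
    have h2 : ¬ d < |v k| := fun h => hcon (Or.inr h)
    have := abs_add_le (u k) (v k)
    linarith
  refine (Set.encard_le_encard hsub).trans ((Set.encard_union_le _ _).trans
    ((add_le_add hcc hdd).trans ?_))
  exact_mod_cast (by omega : n / 2 + n / 2 ≤ n)

/-- The sequence `w` consists of the terms of `u`, each of them repeated. -/
theorem decreasingRearrangement_div_two_le {u w : ℕ → ℝ} (hw : ∃ M, ∀ k, |w k| ≤ M)
    (h0 : ∀ k, w (2 * k) = u k) (h1 : ∀ k, w (2 * k + 1) = u k) (n : ℕ) :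
    decreasingRearrangement u (n / 2) ≤ decreasingRearrangement w n := by
  refine le_decreasingRearrangement hw fun c hc hcard => decreasingRearrangement_le hc ?_
  have hsub : (fun k => 2 * k) '' {k : ℕ | c < |u k|} ∪ (fun k => 2 * k + 1) '' {k : ℕ | c < |u k|}
      ⊆ {k : ℕ | c < |w k|} := by
    rintro _ (⟨k, hk, rfl⟩ | ⟨k, hk, rfl⟩)
    · show c < |w (2 * k)|
      rw [h0]; exact hk
    · show c < |w (2 * k + 1)|
      rw [h1]; exact hk
  have hdisj : Disjoint ((fun k => 2 * k) '' {k : ℕ | c < |u k|})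
      ((fun k => 2 * k + 1) '' {k : ℕ | c < |u k|}) := by
    rw [Set.disjoint_left]
    rintro _ ⟨k, _, rfl⟩ ⟨l, _, hl⟩
    simp only at hl
    omega
  have := (Set.encard_le_encard hsub).trans hcard
  rw [Set.encard_union_eq hdisj, Function.Injective.encard_image (fun a b h => by simpa using h),
    Function.Injective.encard_image (fun a b h => by simpa using h)] at this
  have hfin : {k : ℕ | c < |u k|}.encard ≠ ⊤ := by
    intro htop
    rw [htop] at this
    simp at this
  obtain ⟨m, hm⟩ := ENat.ne_top_iff_exists.1 hfin
  rw [← hm] at this ⊢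
  have : m + m ≤ n := by exact_mod_cast this
  exact_mod_cast (by omega : m ≤ n / 2)

theorem Finsupp.exists_abs_le (a : ℕ →₀ ℝ) : ∃ M, ∀ k, |a k| ≤ M := by
  refine ⟨∑ k ∈ a.support, |a k|, fun k => ?_⟩
  by_cases hk : k ∈ a.support
  · exact Finset.single_le_sum (f := fun k => |a k|) (fun _ _ => abs_nonneg _) hk
  · rw [Finsupp.notMem_support_iff.1 hk, abs_zero]
    exact Finset.sum_nonneg fun _ _ => abs_nonneg _

theorem Finsupp.exists_perm_antitone (a : ℕ →₀ ℝ) :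
    ∃ σ : Equiv.Perm ℕ, Antitone fun k => |a (σ k)| := by
  obtain ⟨N, hN⟩ : ∃ N, ∀ k, N ≤ k → a k = 0 := by
    refine ⟨a.support.sup id + 1, fun k hk => ?_⟩
    by_contra hne
    have := Finset.le_sup (f := id) (Finsupp.mem_support_iff.2 hne)
    simp only [id] at this
    omega
  let f : Fin N → ℝ := fun i => -|a i|
  let σ : Equiv.Perm ℕ := (Tuple.sort f).extendDomain Fin.equivSubtype
  have h1 : ∀ k (hk : k < N), σ k = Tuple.sort f ⟨k, hk⟩ := fun k hk => by
    have := Equiv.Perm.extendDomain_apply_image (Tuple.sort f) Fin.equivSubtype ⟨k, hk⟩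
    simpa using this
  have h2 : ∀ k, N ≤ k → σ k = k := fun k hk =>
    Equiv.Perm.extendDomain_apply_not_subtype _ _ (by omega)
  refine ⟨σ, fun k l hkl => ?_⟩
  simp only
  by_cases hl : l < N
  · have hk : k < N := by omega
    have := Tuple.monotone_sort f (Fin.mk_le_mk.2 hkl : (⟨k, hk⟩ : Fin N) ≤ ⟨l, hl⟩)
    rw [h1 k hk, h1 l hl]
    simpa [f] using this
  · rw [h2 l (by omega), hN l (by omega), abs_zero]
    exact abs_nonneg _

theorem decreasingRearrangement_eq_of_perm {a : ℕ → ℝ} {σ : Equiv.Perm ℕ}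
    (h : Antitone fun k => |a (σ k)|) (n : ℕ) : decreasingRearrangement a n = |a (σ n)| := by
  rw [decreasingRearrangement_congr_injective (a := fun k => a (σ k)) σ.injective (fun _ => rfl)
    (fun l hl => absurd (σ.surjective l) hl), decreasingRearrangement_of_antitone h]

theorem sum_decreasingRearrangement_le (a : ℕ →₀ ℝ) (n : ℕ) :
    ∑ i ∈ Finset.range n, decreasingRearrangement a i ≤ ∑ k ∈ a.support, |a k| := by
  obtain ⟨σ, hσ⟩ := a.exists_perm_antitone
  calc ∑ i ∈ Finset.range n, decreasingRearrangement a i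
      = ∑ i ∈ Finset.range n, |a (σ i)| :=
        Finset.sum_congr rfl fun i _ => decreasingRearrangement_eq_of_perm hσ i
    _ = ∑ k ∈ (Finset.range n).map σ.toEmbedding, |a k| := by simp
    _ ≤ ∑ k ∈ (Finset.range n).map σ.toEmbedding ∪ a.support, |a k| :=
        Finset.sum_le_sum_of_subset_of_nonneg Finset.subset_union_left fun _ _ _ => abs_nonneg _
    _ = ∑ k ∈ a.support, |a k| := by
        refine (Finset.sum_subset Finset.subset_union_right fun k _ hk => ?_).symm
        rw [Finsupp.notMem_support_iff.1 hk, abs_zero]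

theorem sum_decreasingRearrangement_div_two_le (a : ℕ →₀ ℝ) (n : ℕ) :
    ∑ i : Fin n, decreasingRearrangement a ((i : ℕ) / 2) ≤ 2 * ∑ k ∈ a.support, |a k| := by
  rw [Fin.sum_univ_eq_sum_range (fun i => decreasingRearrangement a (i / 2)) n]
  have h : ∀ m, ∑ i ∈ Finset.range (2 * m), decreasingRearrangement a (i / 2) =
      2 * ∑ i ∈ Finset.range m, decreasingRearrangement a i := by
    intro m
    induction m with
    | zero => simp
    | succ m ih =>
      rw [show 2 * (m + 1) = 2 * m + 1 + 1 by ring, Finset.sum_range_succ, Finset.sum_range_succ,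
        ih, Finset.sum_range_succ, show (2 * m + 1) / 2 = m by omega,
        show 2 * m / 2 = m by omega]
      ring
  calc ∑ i ∈ Finset.range n, decreasingRearrangement a (i / 2)
      ≤ ∑ i ∈ Finset.range (2 * n), decreasingRearrangement a (i / 2) :=
        Finset.sum_le_sum_of_subset_of_nonneg (Finset.range_mono (by omega))
          fun _ _ _ => decreasingRearrangement_nonneg _ _
    _ ≤ 2 * ∑ k ∈ a.support, |a k| := by
        rw [h]
        have := sum_decreasingRearrangement_le a n
        linarith

/-- The restriction of `a` to `n` indices where `|a|` is largest has the same first `n`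
rearranged terms. -/
theorem Finsupp.exists_filter_decreasingRearrangement (a : ℕ →₀ ℝ) (n : ℕ) :
    ∃ A : Finset ℕ, A.card = n ∧ ∀ i < n,
      decreasingRearrangement (a.filter (· ∈ A)) i = decreasingRearrangement a i := by
  obtain ⟨σ, hσ⟩ := a.exists_perm_antitone
  refine ⟨(Finset.range n).map σ.toEmbedding, by simp, fun i hi => ?_⟩
  have hval : ∀ k, (a.filter (· ∈ (Finset.range n).map σ.toEmbedding)) (σ k) =
      if k < n then a (σ k) else 0 := by
    intro k
    rw [Finsupp.filter_apply]
    simp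
  have hanti : Antitone fun k =>
      |(a.filter (· ∈ (Finset.range n).map σ.toEmbedding)) (σ k)| := by
    intro k l hkl
    simp only [hval]
    by_cases hl : l < n
    · rw [if_pos hl, if_pos (by omega)]
      exact hσ hkl
    · rw [if_neg hl, abs_zero]
      exact abs_nonneg _
  rw [decreasingRearrangement_eq_of_perm hanti, decreasingRearrangement_eq_of_perm hσ, hval,
    if_pos hi]

end Rearrangement

/-! ### Infimal convolution and norming functionals -/

section NormingFunctionals

open Filter Topology

/-- The `ℓ₁` norm on finitely supported sequences. -/
noncomputable def oneSeminorm : Seminorm ℝ (ℕ →₀ ℝ) :=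
  Seminorm.of (fun a => ∑ k ∈ a.support, |a k|)
    (fun a b => by
      have h : ∀ c : ℕ →₀ ℝ, c.support ⊆ a.support ∪ b.support →
          ∑ k ∈ c.support, |c k| = ∑ k ∈ a.support ∪ b.support, |c k| := fun c hc =>
        Finset.sum_subset hc fun k _ hk => by rw [Finsupp.notMem_support_iff.1 hk, abs_zero]
      rw [h _ Finsupp.support_add, h a Finset.subset_union_left, h b Finset.subset_union_right,
        ← Finset.sum_add_distrib]
      exact Finset.sum_le_sum fun k _ => abs_add_le _ _)
    (fun c a => by
      rw [Finset.mul_sum, Finset.sum_subset (Finsupp.support_smul (b := c) (g := a))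
        fun k _ hk => by rw [Finsupp.notMem_support_iff.1 hk, abs_zero]]
      exact Finset.sum_congr rfl fun k _ => by simp [abs_mul])

theorem oneSeminorm_apply (a : ℕ →₀ ℝ) : oneSeminorm a = ∑ k ∈ a.support, |a k| := rfl

theorem Seminorm.exists_dual_apply_eq {F : Type*} [AddCommGroup F] [Module ℝ F]
    (p : Seminorm ℝ F) (a : F) : ∃ g : Module.Dual ℝ F, g a = p a ∧ ∀ x, |g x| ≤ p x := by
  by_cases ha : a = 0
  · exact ⟨0, by simp [ha], fun x => by simp⟩
  · obtain ⟨g, hg, hgp⟩ := Module.Dual.exists_extension_of_le_seminorm_real (p := p)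
      (Submodule.span ℝ {a}) (p a • (LinearEquiv.coord ℝ F a ha).toLinearMap) (fun x => by
        have hx := LinearEquiv.coord_apply_smul ℝ F a ha x
        rw [← hx, map_smul_eq_mul, LinearMap.smul_apply, smul_eq_mul, mul_comm]
        exact mul_le_mul_of_nonneg_right (le_abs_self _) (apply_nonneg p a))
    refine ⟨g, ?_, hgp⟩
    have := hg ⟨a, Submodule.mem_span_singleton_self a⟩
    rw [this]
    simp [LinearEquiv.coord_self]

/-- The seminorm `P` on finitely supported sequences is given by the supremum formula. -/
def IsRearrangementSup (t : ℕ → ℝ) (ρ : (n : ℕ) → Seminorm ℝ (Fin (n + 1) → ℝ))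
    (P : Seminorm ℝ (ℕ →₀ ℝ)) : Prop :=
  ∀ a : ℕ →₀ ℝ, IsLUB (Set.range fun n : ℕ =>
    t n * ρ n (fun i : Fin (n + 1) => decreasingRearrangement a i)) (P a)

variable {t : ℕ → ℝ} {ρ : (n : ℕ) → Seminorm ℝ (Fin (n + 1) → ℝ)} {P : Seminorm ℝ (ℕ →₀ ℝ)}

theorem IsLatticeNorm.apply_le_of_nonneg {m : ℕ} {ρ : Seminorm ℝ (Fin m → ℝ)}
    (h : IsLatticeNorm ρ) {x y : Fin m → ℝ} (hx : ∀ i, 0 ≤ x i) (hxy : ∀ i, x i ≤ y i) :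
    ρ x ≤ ρ y :=
  h.monotone_abs x y fun i => by
    simp only [Pi.abs_apply]
    rw [abs_of_nonneg (hx i), abs_of_nonneg ((hx i).trans (hxy i))]
    exact hxy i

namespace IsRearrangementSup

theorem congr (hP : IsRearrangementSup t ρ P) {a b : ℕ →₀ ℝ}
    (h : ∀ n, decreasingRearrangement a n = decreasingRearrangement b n) : P a = P b := by
  refine (hP a).unique ?_
  simp only [h]
  exact hP b

theorem mono (hP : IsRearrangementSup t ρ P) (ht : ∀ n, 0 < t n)
    (hρ : ∀ n, IsLatticeNorm (ρ n)) {a b : ℕ →₀ ℝ} (h : ∀ k, |a k| ≤ |b k|) : P a ≤ P b := by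
  refine (hP a).2 ?_
  rintro _ ⟨n, rfl⟩
  refine le_trans ?_ ((hP b).1 ⟨n, rfl⟩)
  exact mul_le_mul_of_nonneg_left ((hρ n).apply_le_of_nonneg
    (fun i => decreasingRearrangement_nonneg _ _)
    fun i => decreasingRearrangement_mono b.exists_abs_le h i) (ht n).le

/-- The term `n = 0` alone controls the supremum norm; this later bounds the rounding error. -/
theorem mul_abs_le (hP : IsRearrangementSup t ρ P) (ht : ∀ n, 0 < t n)
    (hρ : ∀ n, IsNormalizedNorm (ρ n)) (a : ℕ →₀ ℝ) (k : ℕ) : t 0 * |a k| ≤ P a := by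
  refine le_trans ?_ ((hP a).1 ⟨0, rfl⟩)
  refine mul_le_mul_of_nonneg_left (le_trans ?_ ((hρ 0).sup_norm_le _)) (ht 0).le
  refine le_trans ?_ (norm_le_pi_norm _ (0 : Fin 1))
  rw [Real.norm_of_nonneg (decreasingRearrangement_nonneg _ _)]
  refine le_decreasingRearrangement a.exists_abs_le fun c _ hcard => ?_
  by_contra! hlt
  have : {k : ℕ | c < |a k|} = ∅ := by simpa using hcard
  exact this.le hlt

/-- Both summands are copies of `a` with the same rearrangement, so the triangle inequality for `P`
suffices. -/
theorem interleave_le (hP : IsRearrangementSup t ρ P) (a : ℕ →₀ ℝ) :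
    P (a.mapDomain (fun k => 2 * k) + a.mapDomain (fun k => 2 * k + 1)) ≤ 2 * P a := by
  have h : ∀ σ : ℕ → ℕ, Function.Injective σ → P (a.mapDomain σ) = P a := fun σ hσ =>
    hP.congr fun n => decreasingRearrangement_congr_injective hσ
      (fun k => by rw [Finsupp.mapDomain_apply hσ])
      (fun l hl => Finsupp.mapDomain_of_notMem_range _ _ hl) n
  refine (map_add_le_add P _ _).trans ?_
  rw [h _ fun a b h => by simpa using h, h _ fun a b h => by simpa using h, two_mul]

/-- Stretching `a*` by the factor two amounts to repeating every term of `a`, which at most doubles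
`P`. This replaces any symmetry or convexity of `ρ n`. -/
theorem mul_apply_div_two_le (hP : IsRearrangementSup t ρ P) (ht : ∀ n, 0 < t n)
    (hρ : ∀ n, IsLatticeNorm (ρ n)) (a : ℕ →₀ ℝ) (n : ℕ) :
    t n * ρ n (fun i => decreasingRearrangement a ((i : ℕ) / 2)) ≤ 2 * P a := by
  refine le_trans ?_ (hP.interleave_le a)
  refine le_trans ?_ ((hP _).1 ⟨n, rfl⟩)
  refine mul_le_mul_of_nonneg_left ((hρ n).apply_le_of_nonneg
    (fun i => decreasingRearrangement_nonneg _ _) fun i =>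
    decreasingRearrangement_div_two_le (Finsupp.exists_abs_le _) (fun k => ?_) (fun k => ?_) i)
    (ht n).le
  · rw [Finsupp.add_apply, Finsupp.mapDomain_apply (fun a b h => by simpa using h),
      Finsupp.mapDomain_of_notMem_range _ _ (by rintro ⟨l, hl⟩; simp only at hl; omega), add_zero]
  · rw [Finsupp.add_apply, Finsupp.mapDomain_of_notMem_range _ _
      (by rintro ⟨l, hl⟩; simp only at hl; omega),
      Finsupp.mapDomain_apply (f := fun k => 2 * k + 1) (fun a b h => by simpa using h), zero_add]

/-- Each of the functions whose supremum is the norm is dominated by twice the infimal convolution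
of the norm and a multiple of the `ℓ₁` norm. -/
theorem mul_apply_le_inf (hP : IsRearrangementSup t ρ P) (ht : ∀ n, 0 < t n)
    (hρ : ∀ n, IsLatticeNorm (ρ n)) (hρ' : ∀ n, IsNormalizedNorm (ρ n)) (a : ℕ →₀ ℝ) (n : ℕ) :
    t n * ρ n (fun i => decreasingRearrangement a i) ≤
      2 * (P ⊓ (t n).toNNReal • oneSeminorm) a := by
  rw [← div_le_iff₀' two_pos, Seminorm.inf_apply]
  refine le_ciInf fun u => ?_
  rw [div_le_iff₀' two_pos, smul_apply, NNReal.smul_def, Real.coe_toNNReal _ (ht n).le,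
    smul_eq_mul]
  -- For any splitting `a = u + v`, the stretched rearrangement of `u` is controlled by `P`, that of
  -- `v` by the `ℓ₁` norm.
  set v := a - u
  have hav : (a : ℕ → ℝ) = ⇑u + ⇑v := by
    rw [← Finsupp.coe_add]; simp [v]
  have h1 : ρ n (fun i => decreasingRearrangement a i) ≤
      ρ n (fun i => decreasingRearrangement u ((i : ℕ) / 2)) +
        ρ n (fun i => decreasingRearrangement v ((i : ℕ) / 2)) := by
    refine le_trans ((hρ n).apply_le_of_nonneg (fun i => decreasingRearrangement_nonneg _ _)
      fun i => ?_) (map_add_le_add (ρ n) _ _)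
    rw [hav]
    exact decreasingRearrangement_add_le u.exists_abs_le v.exists_abs_le i
  have h2 : ρ n (fun i => decreasingRearrangement v ((i : ℕ) / 2)) ≤ 2 * oneSeminorm v := by
    refine ((hρ' n).le_one_norm _).trans ?_
    simp only [abs_of_nonneg (decreasingRearrangement_nonneg _ _)]
    exact sum_decreasingRearrangement_div_two_le v (n + 1)
  have h3 := hP.mul_apply_div_two_le ht hρ u n
  calc t n * ρ n (fun i => decreasingRearrangement a i)
      ≤ t n * (ρ n (fun i => decreasingRearrangement u ((i : ℕ) / 2)) + 2 * oneSeminorm v) :=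
        mul_le_mul_of_nonneg_left (h1.trans (by gcongr)) (ht n).le
    _ ≤ 2 * (P u + t n * oneSeminorm v) := by linarith

end IsRearrangementSup

/-! ### Discretized functionals -/

/-- The functionals dominated by `P` with all coordinates at most `s` in absolute value and in
`δℤ`. -/
def gridFunctionals (P : Seminorm ℝ (ℕ →₀ ℝ)) (δ s : ℝ) : Set (ℕ → ℝ) :=
  {f | (∀ i, ∃ z : ℤ, f i = z * δ) ∧ (∀ i, |f i| ≤ s) ∧
    ∀ b, |Finsupp.linearCombination ℝ f b| ≤ P b}

/-- The multipliers can be moved from the functional to the vector, where monotonicity of `P`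
absorbs them. This covers both truncation and rounding towards `0`. -/
theorem abs_linearCombination_le_of_mul (hmono : ∀ a b : ℕ →₀ ℝ, (∀ k, |a k| ≤ |b k|) → P a ≤ P b)
    {f f' θ : ℕ → ℝ} (hf : ∀ b, |Finsupp.linearCombination ℝ f b| ≤ P b)
    (hθ : ∀ k, |θ k| ≤ 1) (hf' : ∀ k, f' k = θ k * f k) (b : ℕ →₀ ℝ) :
    |Finsupp.linearCombination ℝ f' b| ≤ P b := by
  let b' : ℕ →₀ ℝ := Finsupp.onFinset b.support (fun k => θ k * b k)
    fun k hk => Finsupp.mem_support_iff.2 (right_ne_zero_of_mul hk)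
  have h : Finsupp.linearCombination ℝ f' b = Finsupp.linearCombination ℝ f b' := by
    rw [Finsupp.linearCombination_apply, Finsupp.linearCombination_apply, Finsupp.onFinset_sum,
      Finsupp.sum]
    · exact Finset.sum_congr rfl fun k _ => by rw [hf', smul_eq_mul, smul_eq_mul]; ring
    · simp
  rw [h]
  refine (hf b').trans (hmono _ _ fun k => ?_)
  simp only [b', Finsupp.onFinset_apply, abs_mul]
  exact mul_le_of_le_one_left (abs_nonneg _) (hθ k)

theorem truncation_mem_gridFunctionals
    (hmono : ∀ a b : ℕ →₀ ℝ, (∀ k, |a k| ≤ |b k|) → P a ≤ P b) {δ s : ℝ} {f : ℕ → ℝ}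
    (hf : f ∈ gridFunctionals P δ s) (k : ℕ) :
    (fun i => if i < k then f i else 0) ∈ gridFunctionals P δ s := by
  refine ⟨fun i => ?_, fun i => ?_, abs_linearCombination_le_of_mul hmono hf.2.2
    (θ := fun i => if i < k then 1 else 0) (fun i => ?_) (fun i => ?_)⟩
  · by_cases h : i < k
    · simpa [h] using hf.1 i
    · exact ⟨0, by simp [h]⟩
  · by_cases h : i < k
    · simpa [h] using hf.2.1 i
    · simpa [h] using (abs_nonneg _).trans (hf.2.1 i)
  · by_cases h : i < k <;> simp [h]
  · simp

theorem zero_mem_gridFunctionals {δ s : ℝ} (hs : 0 ≤ s) : (0 : ℕ → ℝ) ∈ gridFunctionals P δ s := by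
  refine ⟨fun i => ⟨0, by simp⟩, fun i => by simpa using hs, fun b => ?_⟩
  simp

theorem ordinalParam_gridFunctionals
    (hmono : ∀ a b : ℕ →₀ ℝ, (∀ k, |a k| ≤ |b k|) → P a ≤ P b) {δ s : ℝ} (hδ : 0 < δ)
    (hs : 0 ≤ s) (m : ℕ) : OrdinalParam (Ordinal.omega0 ^ (m : Ordinal.{0}))
      (extensionSet (gridFunctionals P δ s) 0 0 m) := by
  have hV : ((fun z : ℤ => (z : ℝ) * δ) '' Set.Icc (-⌈s / δ⌉) ⌈s / δ⌉).Finite :=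
    (Set.finite_Icc _ _).image _
  refine ordinalParam_extensionSet hV (fun f hf i => ?_)
    (fun f hf k => truncation_mem_gridFunctionals hmono hf k) m 0 0
    (zero_mem_gridFunctionals hs) fun _ _ => rfl
  obtain ⟨z, hz⟩ := hf.1 i
  have h := hf.2.1 i
  rw [hz, abs_mul, abs_of_pos hδ, ← le_div_iff₀ hδ] at h
  have h' : |z| ≤ ⌈s / δ⌉ := by exact_mod_cast h.trans (Int.le_ceil _)
  exact ⟨z, abs_le.1 h', hz.symm⟩

/-- Rounding goes towards `0`, so that the rounded coordinate is a multiple of `y` by a factor in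
`[0, 1]`. -/
theorem exists_int_mul_abs_le (y : ℝ) {δ : ℝ} (hδ : 0 < δ) :
    ∃ z : ℤ, |z * δ| ≤ |y| ∧ |y - z * δ| ≤ δ := by
  wlog hy : 0 ≤ y generalizing y
  · obtain ⟨z, h1, h2⟩ := this (-y) (by linarith)
    refine ⟨-z, by simpa using h1, ?_⟩
    rw [← abs_neg]
    push_cast
    convert h2 using 2
    ring
  · have h1 := (le_div_iff₀ hδ).1 (Int.floor_le (y / δ))
    have h2 := (div_lt_iff₀ hδ).1 (Int.lt_floor_add_one (y / δ))
    have h3 : (0 : ℝ) ≤ ⌊y / δ⌋ := by exact_mod_cast Int.floor_nonneg.2 (by positivity)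
    refine ⟨⌊y / δ⌋, ?_, ?_⟩
    · rwa [abs_of_nonneg (by positivity), abs_of_nonneg hy]
    · rw [abs_of_nonneg (by linarith)]
      linarith

theorem IsRearrangementSup.exists_gridFunctional (hP : IsRearrangementSup t ρ P)
    (ht : ∀ n, 0 < t n) (hρ : ∀ n, IsLatticeNorm (ρ n)) (hρ' : ∀ n, IsNormalizedNorm (ρ n))
    (a : ℕ →₀ ℝ) (n : ℕ) :
    ∃ f ∈ extensionSet (gridFunctionals P (t 0 / (4 * (n + 1))) (t n)) 0 0 (n + 1),
      t n * ρ n (fun i => decreasingRearrangement a i) ≤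
        2 * |Finsupp.linearCombination ℝ f a| + P a / 2 := by
  classical
  obtain ⟨A, hA, hAa⟩ := a.exists_filter_decreasingRearrangement (n + 1)
  set a' := a.filter (· ∈ A) with ha'
  obtain ⟨g, hga, hg⟩ := (P ⊓ (t n).toNNReal • oneSeminorm).exists_dual_apply_eq a'
  -- With `t 0 * |a k| ≤ P a`, this grid size makes the total error over `n + 1` coordinates at most
  -- `P a / 4`.
  set δ : ℝ := t 0 / (4 * (n + 1)) with hδdef
  have hδ : 0 < δ := div_pos (ht 0) (by positivity)
  have hgP : ∀ b, |g b| ≤ P b := fun b => (hg b).trans (inf_le_left (a := P) b)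
  have hgt : ∀ k, |g (Finsupp.single k 1)| ≤ t n := fun k => by
    refine (hg _).trans ((inf_le_right (a := P) (Finsupp.single k 1)).trans ?_)
    rw [smul_apply, NNReal.smul_def, Real.coe_toNNReal _ (ht n).le, oneSeminorm_apply,
      Finsupp.support_single_ne_zero _ one_ne_zero]
    simp
  have hglin : ∀ b, Finsupp.linearCombination ℝ (fun k => g (Finsupp.single k 1)) b = g b := by
    intro b
    have : Finsupp.linearCombination ℝ (fun k => g (Finsupp.single k 1)) = g := by
      ext k; simp
    rw [this]
  choose z hz1 hz2 using fun k => exists_int_mul_abs_le (g (Finsupp.single k 1)) hδ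
  let f : ℕ → ℝ := fun k => if k ∈ A then z k * δ else 0
  have hθ : ∀ k, ∃ θ : ℝ, |θ| ≤ 1 ∧ f k = θ * g (Finsupp.single k 1) := by
    intro k
    by_cases hk : k ∈ A
    · simp only [f, if_pos hk]
      by_cases h0 : g (Finsupp.single k 1) = 0
      · refine ⟨0, by simp, ?_⟩
        have := hz1 k
        rw [h0, abs_zero] at this
        rw [zero_mul]
        exact abs_nonpos_iff.1 this
      · refine ⟨z k * δ / g (Finsupp.single k 1), ?_, by field_simp⟩
        rw [abs_div]
        exact div_le_one_of_le₀ (hz1 k) (abs_nonneg _)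
    · exact ⟨0, by simp, by simp [f, hk]⟩
  choose θ hθ1 hθf using hθ
  refine ⟨f, ⟨⟨fun k => ?_, fun k => ?_, abs_linearCombination_le_of_mul
    (fun _ _ h => hP.mono ht hρ h) (fun b => by rw [hglin]; exact hgP b) hθ1 hθf⟩,
    fun i hi => absurd hi (Nat.not_lt_zero i), ?_⟩, ?_⟩
  · by_cases hk : k ∈ A
    · exact ⟨z k, by simp [f, hk]⟩
    · exact ⟨0, by simp [f, hk]⟩
  · by_cases hk : k ∈ A
    · simpa [f, hk] using (hz1 k).trans (hgt k)
    · simpa [f, hk] using (ht n).le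
  · have hsub : {i | 0 ≤ i ∧ f i ≠ 0} ⊆ (A : Set ℕ) := by
      rintro i ⟨-, hi⟩
      by_contra hcon
      exact hi (if_neg hcon)
    refine (Set.encard_le_encard hsub).trans ?_
    rw [Set.encard_coe_eq_coe_finsetCard, hA]
  · have hfa : Finsupp.linearCombination ℝ f a = ∑ k ∈ A, a k * (z k * δ) := by
      rw [Finsupp.linearCombination_apply, Finsupp.sum]
      simp only [f, smul_eq_mul, mul_ite, mul_zero]
      rw [Finset.sum_ite_mem]
      refine Finset.sum_subset Finset.inter_subset_right fun k hk hk' => ?_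
      have : a k = 0 := by
        by_contra hne
        exact hk' (Finset.mem_inter.2 ⟨Finsupp.mem_support_iff.2 hne, hk⟩)
      rw [this, zero_mul]
    have hga' : g a' = ∑ k ∈ A, a k * g (Finsupp.single k 1) := by
      rw [← hglin a', Finsupp.linearCombination_apply, Finsupp.sum_of_support_subset (s := A)]
      · refine Finset.sum_congr rfl fun k hk => ?_
        rw [ha', Finsupp.filter_apply_pos _ _ hk, smul_eq_mul]
      · intro k hk
        rw [ha', Finsupp.support_filter, Finset.mem_filter] at hk
        exact hk.2
      · simp
    have hdiff : |g a' - Finsupp.linearCombination ℝ f a| ≤ P a / 4 := by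
      rw [hga', hfa, ← Finset.sum_sub_distrib]
      refine (Finset.abs_sum_le_sum_abs _ _).trans ?_
      have hterm : ∀ k ∈ A, |a k * g (Finsupp.single k 1) - a k * (z k * δ)| ≤
          P a / (4 * (n + 1)) := by
        intro k _
        rw [← mul_sub, abs_mul]
        calc |a k| * |g (Finsupp.single k 1) - z k * δ| ≤ |a k| * δ :=
              mul_le_mul_of_nonneg_left (hz2 k) (abs_nonneg _)
          _ = t 0 * |a k| / (4 * (n + 1)) := by rw [hδdef]; ring
          _ ≤ P a / (4 * (n + 1)) := by
              have := hP.mul_abs_le ht hρ' a k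
              gcongr
      refine (Finset.sum_le_sum hterm).trans ?_
      rw [Finset.sum_const, hA, nsmul_eq_mul]
      push_cast
      apply le_of_eq
      field_simp
    have hmain := hP.mul_apply_le_inf ht hρ hρ' a' n
    rw [← hga] at hmain
    have heq : (fun i : Fin (n + 1) => decreasingRearrangement a' i) =
        fun i : Fin (n + 1) => decreasingRearrangement a i := funext fun i => hAa i i.2
    rw [heq] at hmain
    have h1 := (abs_le.1 hdiff).2
    have h2 := le_abs_self (Finsupp.linearCombination ℝ f a)
    linarith

/-- A continuous family of functionals, indexed by `[0, ω ^ ω]`, which is norming up to the factor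
`4`. -/
theorem IsRearrangementSup.exists_continuousMap (hP : IsRearrangementSup t ρ P)
    (ht : ∀ n, 0 < t n) (ht_lim : Tendsto t atTop (𝓝 0)) (hρ : ∀ n, IsLatticeNorm (ρ n))
    (hρ' : ∀ n, IsNormalizedNorm (ρ n)) :
    ∃ φ : C(OrdinalInterval (Ordinal.omega0 ^ Ordinal.omega0), ℕ → ℝ),
      (∀ β a, |Finsupp.linearCombination ℝ (φ β) a| ≤ P a) ∧
      ∀ a M, (∀ β, |Finsupp.linearCombination ℝ (φ β) a| ≤ M) → P a ≤ 4 * M := by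
  let S : ℕ → Set (ℕ → ℝ) := fun n =>
    extensionSet (gridFunctionals P (t 0 / (4 * (n + 1))) (t n)) 0 0 (n + 1)
  have hparam := ordinalParam_iUnion_omega0_opow_omega0 (S := S) (x := 0)
    (fun n => ordinalParam_gridFunctionals (fun _ _ h => hP.mono ht hρ h)
      (div_pos (ht 0) (by positivity)) (ht n).le (n + 1))
    (Set.mem_iUnion.2 ⟨0, zero_mem_gridFunctionals (ht 0).le, fun _ _ => rfl, by simp⟩)
    (fun s hs => tendsto_pi_nhds.2 fun i =>
      squeeze_zero_norm (fun n => (hs n).1.2.1 i) ht_lim)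
  obtain ⟨φ, hφ⟩ := hparam.exists_continuousMap
  refine ⟨φ, fun β a => ?_, fun a M hM => ?_⟩
  · obtain ⟨n, hn⟩ := Set.mem_iUnion.1 (hφ ▸ Set.mem_range_self β)
    exact hn.1.2.2 a
  -- Taking the supremum over `n` in `exists_gridFunctional`; absorbing `P a / 2` on the left gives
  -- the factor `4`.
  · have h : P a ≤ 2 * M + P a / 2 := by
      refine (hP a).2 ?_
      rintro _ ⟨n, rfl⟩
      obtain ⟨f, hf, hfa⟩ := hP.exists_gridFunctional ht hρ hρ' a n
      obtain ⟨β, rfl⟩ : f ∈ Set.range φ := hφ ▸ Set.mem_iUnion.2 ⟨n, hf⟩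
      have := hM β
      simp only at hfa ⊢
      linarith
    linarith

end NormingFunctionals

/-! ### Passage from finitely supported sequences to `E` -/

section Embedding

open Filter Topology

theorem isExpansion_finsupp {E : Type*} [NormedAddCommGroup E] [NormedSpace ℝ E] (e : ℕ → E)
    (a : ℕ →₀ ℝ) : IsExpansion e a (Finsupp.linearCombination ℝ e a) := by
  refine tendsto_const_nhds.congr' ?_
  filter_upwards [eventually_gt_atTop (a.support.sup id)] with N hN
  rw [Finsupp.linearCombination_apply, Finsupp.sum]
  refine Finset.sum_subset (fun k hk => ?_) fun k _ hk => ?_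
  · exact Finset.mem_range.2 ((Finset.le_sup (f := id) hk).trans_lt hN)
  · rw [Finsupp.notMem_support_iff.1 hk, zero_smul]

theorem denseRange_linearCombination {E : Type*} [NormedAddCommGroup E] [NormedSpace ℝ E]
    {e : ℕ → E} (he : IsBasisSequence e) : DenseRange (Finsupp.linearCombination ℝ e) := by
  intro x
  obtain ⟨a, ha, -⟩ := he x
  refine mem_closure_of_tendsto ha (Eventually.of_forall fun N => ?_)
  refine ⟨∑ k ∈ Finset.range N, Finsupp.single k (a k), ?_⟩
  simp

end Embedding

theorem mainTheorem3
    (t : ℕ → ℝ) (ht_pos : ∀ n, 0 < t n) (ht_anti : Antitone t)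
    (ht_lim : Filter.Tendsto t Filter.atTop (nhds 0))
    -- everything is indexed from `0`: `t n` and `ρ n` stand for `t_{n+1}` and `ρ_{n+1}`
    (ρ : (n : ℕ) → Seminorm ℝ (Fin (n + 1) → ℝ))
    (hρ_lattice : ∀ n, IsLatticeNorm (ρ n)) (hρ_normalized : ∀ n, IsNormalizedNorm (ρ n))
    {E : Type*} [NormedAddCommGroup E] [NormedSpace ℝ E] [CompleteSpace E]
    (e : ℕ → E) (he : IsBasisSequence e)
    (h_norm : ∀ (a : ℕ → ℝ) (x : E), IsExpansion e a x →
      IsLUB (Set.range fun n : ℕ =>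
        t n * ρ n (fun i : Fin (n + 1) => decreasingRearrangement a i)) ‖x‖) :
    ∃ S : Submodule ℝ (COrdinal (Ordinal.omega0 ^ Ordinal.omega0)), Nonempty (E ≃L[ℝ] S) := by
  let T : (ℕ →₀ ℝ) →ₗ[ℝ] E := Finsupp.linearCombination ℝ e
  let P : Seminorm ℝ (ℕ →₀ ℝ) := (normSeminorm ℝ E).comp T
  have hPT : ∀ a, P a = ‖T a‖ := fun a => rfl
  have hP : IsRearrangementSup t ρ P := fun a => h_norm a (T a) (isExpansion_finsupp e a)
  obtain ⟨φ, hφ1, hφ2⟩ := hP.exists_continuousMap ht_pos ht_lim hρ_lattice hρ_normalized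
  let Φ₀ : (ℕ →₀ ℝ) →ₗ[ℝ] COrdinal (Ordinal.omega0 ^ Ordinal.omega0) :=
    Finsupp.linearCombination ℝ fun k =>
      (⟨fun β => φ β k, (continuous_apply k).comp φ.continuous⟩ : COrdinal _)
  have hΦ₀ : ∀ a β, Φ₀ a β = Finsupp.linearCombination ℝ (φ β) a := by
    intro a β
    simp [Φ₀, Finsupp.linearCombination_apply, Finsupp.sum, ContinuousMap.sum_apply]
  have hdense : DenseRange T := denseRange_linearCombination he
  have hbound : ∀ a, ‖Φ₀ a‖ ≤ 1 * ‖T a‖ := fun a => by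
    rw [one_mul]
    refine (ContinuousMap.norm_le _ (norm_nonneg _)).2 fun β => ?_
    rw [hΦ₀]
    exact hφ1 β a
  let Φ : E →L[ℝ] COrdinal (Ordinal.omega0 ^ Ordinal.omega0) := Φ₀.extendOfNorm T
  have hΦ : ∀ a, Φ (T a) = Φ₀ a := LinearMap.extendOfNorm_eq hdense ⟨1, hbound⟩
  -- The estimate is a closed condition, so it passes from the dense range of `T` to all of `E`.
  have hlower : ∀ x, ‖x‖ ≤ 4 * ‖Φ x‖ := by
    intro x
    refine hdense.induction_on (p := fun x => ‖x‖ ≤ 4 * ‖Φ x‖) x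
      (isClosed_le continuous_norm (by fun_prop)) fun a => ?_
    rw [hΦ, ← hPT]
    refine hφ2 a _ fun β => ?_
    rw [← hΦ₀]
    exact (Φ₀ a).norm_coe_le_norm β
  have hinj : Function.Injective Φ := by
    refine (injective_iff_map_eq_zero Φ).2 fun x hx => ?_
    have := hlower x
    rw [hx, norm_zero, mul_zero] at this
    exact norm_le_zero_iff.1 this
  refine ⟨LinearMap.range Φ.toLinearMap, ⟨(LinearEquiv.ofInjective Φ.toLinearMap
    hinj).toContinuousLinearEquivOfBounds ‖Φ‖ 4 (fun x => Φ.le_opNorm x) fun y => ?_⟩⟩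
  obtain ⟨x, rfl⟩ := (LinearEquiv.ofInjective Φ.toLinearMap hinj).surjective y
  rw [LinearEquiv.symm_apply_apply]
  exact hlower x
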